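/- Let $\mathcal X$ be a Borel subset of $\mathbb R^d$, let $\lambda$ be Lebesgue measure on $\mathcal X$, and let $P_0$ be a probability measure on $\mathcal X$ with Lebesgue density $\eta_0 = dP_0/d\lambda$. Let $X_1, X_2, \dots$ be IID from $P_0$ (the coordinates of the product space $(\mathcal X,\mathcal B,P_0)^\infty$), let $\mathbb P_n$ be the empirical distribution of $X_1,\dots,X_n$, write $Pf=\int f\,dP$, and $\mathbb G_n f = n^{1/2}(\mathbb P_n-P_0)f$. Let $P_0^*$ denote outer probability and $E_0^*$ outer expectation. Events $A_n$ that need not be measurable are said to hold with probability tending to one if $P_0^*(A_n^c)\to 0$, and $Y_n = o_{P_0^*}(n^{-r})$ means $P_0^*(|Y_n|\ge \varepsilon n^{-r})\to 0$ for every $\varepsilon>0$. A class $\mathcal F$ of measurable, $P_0$-integrable functions $\mathcal X\to\mathbb R$ is $P_0$-Donsker if for every $n$ almost every sample path of $f\mapsto\mathbb G_n f$ is bounded on $\mathcal F$ and $\mathbb G_n$ converges weakly in $\ell^\infty(\mathcal F)$ to a tight, Borel measurable limit $\mathbb G_0$, that is, $E_0^*h(\mathbb G_n)\to E\,h(\mathbb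 G_0)$ for every bounded continuous $h:\ell^\infty(\mathcal F)\to\mathbb R$. For each $n$ let $\eta_n:\mathcal X\to\mathbb R$ be a function determined by $X_1,\dots,X_n$ (an estimator of $\eta_0$). Let $\psi_0=\int\eta_0^2\,d\lambda$ and $\phi_0 = 2(\eta_0-\psi_0)$, and define the one-step, plug-in and empirical-mean plug-in estimators $$\psi_{n,1}=2\,\mathbb P_n\eta_n-\int\eta_n^2\,d\lambda,\qquad \psi_{n,2}=\int\eta_n^2\,d\lambda,\qquad \psi_{n,3}=\mathbb P_n\eta_n .$$ An estimator $\psi_n$ of $\psi_0$ is asymptotically linear with influence function $\phi_0$ if $P_0\phi_0=0$, $P_0\phi_0^2<\infty$ and $\psi_n=\psi_0+\mathbb P_n\phi_0+o_{P_0^*}(n^{-1/2})$. Suppose that there is a $P_0$-Donsker class $\mathcal F$ such that $\eta_n\in\mathcal F$ with probability tending to one, that there is $M\in(0,\infty)$ such that $\|\eta_0\|_\infty<M$ and, with probability tending to one, $\|\eta_n\|_\infty<M$ (essential suprema with respect to $\lambda$), and that $\|\eta_n-\eta_0\|_{L_2(\lambda)}=o_{P_0^*}(n^{-1/4})$. Then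 $\psi_{n,1}$ is asymptotically linear with influence function $\phi_0$. If in addition $\int\eta_n^2\,d\lambda-\mathbb P_n\eta_n=o_{P_0^*}(n^{-1/2})$, then $\psi_{n,2}$ and $\psi_{n,3}$ are asymptotically linear with influence function $\phi_0$ as well. -/

import Mathlib

open MeasureTheory ProbabilityTheory Filter Topology
open scoped ENNReal BoundedContinuousFunction

noncomputable section

namespace AvgDensity

/-! ### Outer expectation and weak convergence of possibly non-measurable maps -/

section Outer

variable {Ω : Type*} [MeasurableSpace Ω]

/-- The outer expectation `E* T` of a bounded, possibly non-measurable function `T` on a probability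
space: the infimum of `E U` over the measurable integrable majorants `U` of `T`. -/
def outerExpectation (μ : Measure Ω) (T : Ω → ℝ) : ℝ :=
  sInf {c : ℝ | ∃ U : Ω → ℝ, Measurable U ∧ Integrable U μ ∧ (∀ᵐ ω ∂μ, T ω ≤ U ω) ∧
    c = ∫ ω, U ω ∂μ}

/-- Weak convergence, in a metric space `D`, of the possibly non-measurable maps `G n : Ω → D`
to a Borel law `ν`: `E* h(G n) → ∫ h dν` for all bounded continuous `h : D → ℝ`. -/
def WeaklyConverges {D : Type*} [MetricSpace D] [MeasurableSpace D] [BorelSpace D]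
    (μ : Measure Ω) (G : ℕ → Ω → D) (ν : Measure D) : Prop :=
  ∀ h : D →ᵇ ℝ,
    Tendsto (fun n => outerExpectation μ (fun ω => h (G n ω))) atTop (𝓝 (∫ z, h z ∂ν))

/-- The events `A n` hold with probability tending to one. Events need not be measurable, so this
says that the outer probability of the complement tends to zero (a measure applied to an
arbitrary set is its outer probability). -/
def WithProbTendingToOne (μ : Measure Ω) (A : ℕ → Set Ω) : Prop :=
  Tendsto (fun n => μ (A n)ᶜ) atTop (𝓝 0)

/-- `Y n = o(n ^ (-r))` in outer probability, for `Y n` with values in `[0, ∞]`. -/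
def IsLittleOP (μ : Measure Ω) (r : ℝ) (Y : ℕ → Ω → ℝ≥0∞) : Prop :=
  ∀ ε : ℝ, 0 < ε →
    Tendsto (fun n : ℕ => μ {ω | ENNReal.ofReal (ε * (n : ℝ) ^ (-r)) ≤ Y n ω}) atTop (𝓝 0)

end Outer

/-! ### The bounded functions on a class, and its Borel sets -/

/-- `ℓ^∞(F)`: the bounded real functions on `F` with the supremum norm. -/
abbrev EllInfty {α : Type*} (F : Set α) : Type _ := lp (fun _ : F => ℝ) ∞

instance EllInfty.instMeasurableSpace {α : Type*} (F : Set α) : MeasurableSpace (EllInfty F) :=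
  borel _

instance EllInfty.instBorelSpace {α : Type*} (F : Set α) : BorelSpace (EllInfty F) := ⟨rfl⟩

/-! ### IID samples, empirical processes and Donsker classes -/

section Empirical

variable {X : Type*} [MeasurableSpace X]

/-- The law of an IID sequence from `P`, on the space of all sequences; the observations
are the coordinates. -/
abbrev iidLaw (P : Measure X) [IsProbabilityMeasure P] : Measure (ℕ → X) :=
  Measure.infinitePi (fun _ : ℕ => P)

/-- The first `n` observations. -/
def sample (n : ℕ) (ω : ℕ → X) : Fin n → X := fun i => ω i

/-- `ℙₙ f`, the average of `f` over the sample. -/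
def empMean {n : ℕ} (x : Fin n → X) (f : X → ℝ) : ℝ := (∑ i, f (x i)) / n

/-- `𝔾ₙ f = √n (ℙₙ - P) f`. -/
def empG (P : Measure X) (n : ℕ) (ω : ℕ → X) (f : X → ℝ) : ℝ :=
  √(n : ℝ) * (empMean (sample n ω) f - ∫ x, f x ∂P)

open Classical in
/-- `𝔾ₙ` as a map into `ℓ^∞(F)`; it is set to `0` at the points where its sample path is
unbounded (a null set for the classes `F` considered below). -/
def empGMap (P : Measure X) (F : Set (X → ℝ)) (n : ℕ) (ω : ℕ → X) : EllInfty F :=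
  if h : Memℓp (fun f : F => empG P n ω f) ∞ then ⟨fun f : F => empG P n ω f, h⟩ else 0

/-- `F` is a `P`-Donsker class: a class of measurable, `P`-integrable functions for which almost
all sample paths of `𝔾ₙ` are bounded on `F`, and `𝔾ₙ` converges weakly in `ℓ^∞(F)` to a tight
Borel probability law. -/
structure IsDonsker (P : Measure X) [IsProbabilityMeasure P] (F : Set (X → ℝ)) : Prop where
  measurable : ∀ f ∈ F, Measurable f
  integrable : ∀ f ∈ F, Integrable f P
  bounded : ∀ n : ℕ, ∀ᵐ ω ∂(iidLaw P), ∃ C : ℝ, ∀ f ∈ F, |empG P n ω f| ≤ C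
  weaklyConverges : ∃ ν : Measure (EllInfty F), IsProbabilityMeasure ν ∧
    IsTightMeasureSet {ν} ∧ WeaklyConverges (iidLaw P) (empGMap P F) ν

/-- A sequence of estimators `T n` (the value at sample size `n` being a function of the
first `n` observations) is asymptotically linear for the real number `ψ` with influence function
`φ`: `φ` has `P`-mean zero and finite `P`-variance, and `T n = ψ + ℙₙ φ + o(n^(-1/2))` in outer
probability. -/
structure IsAsymptoticallyLinear (P : Measure X) [IsProbabilityMeasure P]
    (T : ∀ n : ℕ, (Fin n → X) → ℝ) (ψ : ℝ) (φ : X → ℝ) : Prop where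
  memLp : MemLp φ 2 P
  mean_zero : ∫ x, φ x ∂P = 0
  remainder : IsLittleOP (iidLaw P) (1 / 2)
    (fun n ω => ‖T n (sample n ω) - ψ - empMean (sample n ω) φ‖ₑ)

end Empirical

/-! ### The average density value and its estimators -/

section Density

/-- Lebesgue measure on a subset `S` of `ℝᵈ`, as a measure on the type of points of `S`. -/
def lebesgueOn {d : ℕ} (S : Set (EuclideanSpace ℝ (Fin d))) : Measure S :=
  (volume : Measure (EuclideanSpace ℝ (Fin d))).comap Subtype.val

variable {X : Type*} [MeasurableSpace X]

/-- `η` is (a version of) the density of `P` with respect to `lam`. -/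
structure IsDensityOf (lam : Measure X) (η : X → ℝ) (P : Measure X) : Prop where
  measurable : Measurable η
  nonneg : ∀ᵐ x ∂lam, 0 ≤ η x
  eq_withDensity : P = lam.withDensity (fun x => ENNReal.ofReal (η x))

/-- The average density value `∫ η²`. -/
def avgDensity (lam : Measure X) (η : X → ℝ) : ℝ := ∫ x, η x ^ 2 ∂lam

/-- The influence function `x ↦ 2 (η x - ∫ η²)`. -/
def influence (lam : Measure X) (η : X → ℝ) : X → ℝ := fun x => 2 * (η x - avgDensity lam η)

/-- The one-step estimator `2 ℙₙ ηₙ - ∫ ηₙ²` built from a nuisance estimator `η`, which maps the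
first `n` observations to a real function `η n x` on the sample space. -/
def oneStep (lam : Measure X) (η : ∀ n : ℕ, (Fin n → X) → X → ℝ) (n : ℕ) (x : Fin n → X) : ℝ :=
  2 * empMean x (η n x) - avgDensity lam (η n x)

/-- The plug-in estimator `∫ ηₙ²`. -/
def plugIn (lam : Measure X) (η : ∀ n : ℕ, (Fin n → X) → X → ℝ) (n : ℕ) (x : Fin n → X) : ℝ :=
  avgDensity lam (η n x)

/-- The empirical mean plug-in estimator `ℙₙ ηₙ`. -/
def meanPlugIn (η : ∀ n : ℕ, (Fin n → X) → X → ℝ) (n : ℕ) (x : Fin n → X) : ℝ :=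
  empMean x (η n x)

end Density

end AvgDensity

end

/-!
The error of the one-step estimator satisfies the von Mises expansion
`ψₙ,₁ - ψ₀ - ℙₙ φ₀ = 2 (ℙₙ - P₀) (ηₙ - η₀) - ∫ (ηₙ - η₀)² dλ`.
The rate on `‖ηₙ - η₀‖` makes the quadratic term `o(n ^ (-1/2))`. The linear term is
`2 n ^ (-1/2) 𝔾ₙ (ηₙ - η₀)`, and `𝔾ₙ (ηₙ - η₀)` vanishes in outer probability by asymptotic
equicontinuity of the empirical process; as `η₀` itself need not lie in the Donsker class, it is
compared with a fixed member of the class that is close to it in `L²(P₀)`.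

Equicontinuity follows from weak convergence without identifying the limit as a Brownian bridge.
If the limit law charges a ball, `𝔾ₙ` hits that ball with probability bounded away from zero. For
`f` and `g` close in `L²(P₀)`, Chebyshev's inequality makes `𝔾ₙ f` and `𝔾ₙ g` close except on an
event of smaller probability, so the centre of the ball nearly agrees at `f` and `g`. By tightness,
finitely many such balls carry almost all of the limit law.
-/

namespace AvgDensity

section Outer

variable {Ω : Type*} [MeasurableSpace Ω] {μ : Measure Ω}

theorem mul_measureReal_le_outerExpectation [IsFiniteMeasure μ] {T : Ω → ℝ} (hT₀ : ∀ ω, 0 ≤ T ω)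
    (hT : BddAbove (Set.range T)) (ε : ℝ) :
    ε * μ.real {ω | ε ≤ T ω} ≤ outerExpectation μ T := by
  obtain ⟨K, hK⟩ := hT
  refine le_csInf ⟨_, fun _ => K, measurable_const, integrable_const _,
    ae_of_all _ fun ω => hK ⟨ω, rfl⟩, rfl⟩ ?_
  rintro _ ⟨U, -, hUint, hTU, rfl⟩
  rcases le_or_gt ε 0 with hε | hε
  · exact (mul_nonpos_of_nonpos_of_nonneg hε measureReal_nonneg).trans
      (integral_nonneg_of_ae (hTU.mono fun ω hω => (hT₀ ω).trans hω))
  · have hsub : μ.real {ω | ε ≤ T ω} ≤ μ.real {ω | ε ≤ U ω} :=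
      ENNReal.toReal_mono (measure_ne_top _ _)
        (measure_mono_ae (hTU.mono fun ω hω (h : ε ≤ T ω) => h.trans hω))
    exact (mul_le_mul_of_nonneg_left hsub hε.le).trans
      (mul_meas_ge_le_integral_of_nonneg (hTU.mono fun ω hω => (hT₀ ω).trans hω) hUint ε)

theorem outerExpectation_le_measureReal [IsFiniteMeasure μ] {T : Ω → ℝ} (hT₀ : ∀ ω, 0 ≤ T ω)
    {s : Set Ω} (hT : ∀ ω, T ω ≤ s.indicator 1 ω) : outerExpectation μ T ≤ μ.real s := by
  have hmeas : MeasurableSet (toMeasurable μ s) := measurableSet_toMeasurable μ s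
  refine csInf_le ⟨0, ?_⟩ ⟨(toMeasurable μ s).indicator 1, measurable_one.indicator hmeas,
    (integrable_const 1).indicator hmeas, ae_of_all _ fun ω => (hT ω).trans ?_, ?_⟩
  · rintro _ ⟨U, -, -, hTU, rfl⟩
    exact integral_nonneg_of_ae (hTU.mono fun ω hω => (hT₀ ω).trans hω)
  · exact Set.indicator_le_indicator_of_subset (subset_toMeasurable μ s) (fun _ => zero_le_one) ω
  · rw [integral_indicator_one hmeas, measureReal_def, measureReal_def, measure_toMeasurable]

end Outer

section Portmanteau

variable {Ω D : Type*} [MeasurableSpace Ω] [MetricSpace D]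

/-- Mathlib's thickened indicator of `E`, which is `ℝ≥0`-valued, as a real test function for
weak convergence. -/
noncomputable def realThickenedIndicator {δ : ℝ} (hδ : 0 < δ) (E : Set D) : D →ᵇ ℝ :=
  BoundedContinuousFunction.ofNormedAddCommGroup (fun z => (thickenedIndicator hδ E z : ℝ))
    (by fun_prop) 1 fun z => by simpa using thickenedIndicator_le_one hδ E z

theorem realThickenedIndicator_nonneg {δ : ℝ} (hδ : 0 < δ) (E : Set D) (z : D) :
    0 ≤ realThickenedIndicator hδ E z :=
  NNReal.coe_nonneg _

theorem realThickenedIndicator_le_one {δ : ℝ} (hδ : 0 < δ) (E : Set D) (z : D) :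
    realThickenedIndicator hδ E z ≤ 1 :=
  NNReal.coe_le_one.2 (thickenedIndicator_le_one hδ E z)

theorem realThickenedIndicator_of_mem {δ : ℝ} (hδ : 0 < δ) {E : Set D} {z : D} (hz : z ∈ E) :
    realThickenedIndicator hδ E z = 1 :=
  NNReal.coe_eq_one.2 (thickenedIndicator_one hδ E hz)

variable [MeasurableSpace D] [BorelSpace D] {μ : Measure Ω} [IsFiniteMeasure μ]
  {G : ℕ → Ω → D} {ν : Measure D}

theorem WeaklyConverges.limsup_measure_preimage_le_ofReal_integral (h : WeaklyConverges μ G ν)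
    {f : D →ᵇ ℝ} (hf₀ : ∀ z, 0 ≤ f z) {E : Set D} (hf : ∀ z ∈ E, 1 ≤ f z) :
    limsup (fun n => μ (G n ⁻¹' E)) atTop ≤ ENNReal.ofReal (∫ z, f z ∂ν) := by
  rw [← (ENNReal.tendsto_ofReal (h f)).limsup_eq]
  refine limsup_le_limsup (Eventually.of_forall fun n => ?_)
  have hbdd : BddAbove (Set.range fun ω => f (G n ω)) :=
    f.isBounded_range.bddAbove.mono (Set.range_comp_subset_range (G n) f)
  have hmarkov := mul_measureReal_le_outerExpectation (μ := μ) (fun ω => hf₀ (G n ω)) hbdd 1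
  calc μ (G n ⁻¹' E) ≤ μ {ω | 1 ≤ f (G n ω)} := measure_mono fun ω hω => hf _ hω
    _ = ENNReal.ofReal (μ.real {ω | 1 ≤ f (G n ω)}) := by rw [ofReal_measureReal]
    _ ≤ _ := ENNReal.ofReal_le_ofReal (by rwa [one_mul] at hmarkov)

theorem WeaklyConverges.ofReal_integral_le_liminf_measure_preimage (h : WeaklyConverges μ G ν)
    {f : D →ᵇ ℝ} (hf₀ : ∀ z, 0 ≤ f z) {E : Set D} (hf : ∀ z, f z ≤ E.indicator 1 z) :
    ENNReal.ofReal (∫ z, f z ∂ν) ≤ liminf (fun n => μ (G n ⁻¹' E)) atTop := by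
  rw [← (ENNReal.tendsto_ofReal (h f)).liminf_eq]
  refine liminf_le_liminf (Eventually.of_forall fun n => ?_)
  rw [← ofReal_measureReal (μ := μ)]
  exact ENNReal.ofReal_le_ofReal
    (outerExpectation_le_measureReal (fun ω => hf₀ (G n ω)) fun ω => hf (G n ω))

variable [IsFiniteMeasure ν]

theorem WeaklyConverges.limsup_measure_preimage_le (h : WeaklyConverges μ G ν) {C : Set D}
    (hC : IsClosed C) : limsup (fun n => μ (G n ⁻¹' C)) atTop ≤ ν C := by
  have hlim := tendsto_integral_thickenedIndicator_of_isClosed ν hC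
    (fun _ => Nat.one_div_pos_of_nat) tendsto_one_div_add_atTop_nhds_zero_nat
  rw [← ofReal_measureReal (μ := ν)]
  exact ge_of_tendsto' (ENNReal.tendsto_ofReal hlim) fun k =>
    h.limsup_measure_preimage_le_ofReal_integral (realThickenedIndicator_nonneg _ C)
      fun z hz => (realThickenedIndicator_of_mem Nat.one_div_pos_of_nat hz).ge

theorem WeaklyConverges.le_liminf_measure_preimage (h : WeaklyConverges μ G ν) {U : Set D}
    (hU : IsOpen U) : ν U ≤ liminf (fun n => μ (G n ⁻¹' U)) atTop := by
  let f (k : ℕ) : D →ᵇ ℝ := 1 - realThickenedIndicator (Nat.one_div_pos_of_nat (n := k)) Uᶜ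
  have hf₀ k z : 0 ≤ f k z := sub_nonneg.2 (realThickenedIndicator_le_one _ _ z)
  have hfU k z : f k z ≤ U.indicator 1 z := by
    by_cases hz : z ∈ U
    · simpa [f, hz] using realThickenedIndicator_nonneg _ Uᶜ z
    · simp [f, hz, realThickenedIndicator_of_mem]
  have hint k : ∫ z, f k z ∂ν =
      ν.real Set.univ - ∫ z, realThickenedIndicator (Nat.one_div_pos_of_nat (n := k)) Uᶜ z ∂ν := by
    simpa [f] using integral_sub (integrable_const (1 : ℝ))
      ((realThickenedIndicator (Nat.one_div_pos_of_nat (n := k)) Uᶜ).integrable ν)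
  have hlim : Tendsto (fun k => ∫ z, f k z ∂ν) atTop (𝓝 (ν.real U)) := by
    simp only [hint]
    rw [← compl_compl U, measureReal_compl hU.measurableSet.compl, compl_compl]
    exact tendsto_const_nhds.sub (tendsto_integral_thickenedIndicator_of_isClosed ν
      hU.isClosed_compl (fun _ => Nat.one_div_pos_of_nat) tendsto_one_div_add_atTop_nhds_zero_nat)
  rw [← ofReal_measureReal (μ := ν)]
  exact le_of_tendsto' (ENNReal.tendsto_ofReal hlim) fun k =>
    h.ofReal_integral_le_liminf_measure_preimage (hf₀ k) (hfU k)

end Portmanteau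

theorem exists_finset_measure_ball_ne_zero {D : Type*} [MetricSpace D] [MeasurableSpace D]
    {ν : Measure D} (hν : IsTightMeasureSet {ν}) {r : ℝ} (hr : 0 < r) {ε : ℝ≥0∞} (hε : 0 < ε) :
    ∃ t : Finset D, (∀ z ∈ t, ν (Metric.ball z r) ≠ 0) ∧ ν (⋃ z ∈ t, Metric.ball z r)ᶜ ≤ ε := by
  classical
  obtain ⟨K, hK, hνK⟩ := isTightMeasureSet_iff_exists_isCompact_measure_compl_le.1 hν ε hε
  obtain ⟨s, hKs⟩ : ∃ s : Finset D, K ⊆ ⋃ z ∈ s, Metric.ball z r := by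
    obtain ⟨s, -, hs, hKs⟩ := hK.finite_cover_balls hr
    exact ⟨hs.toFinset, by simpa using hKs⟩
  refine ⟨{z ∈ s | ν (Metric.ball z r) ≠ 0}, fun z hz => (Finset.mem_filter.1 hz).2, ?_⟩
  have hnull : ν (⋃ z ∈ {z ∈ s | ν (Metric.ball z r) = 0}, Metric.ball z r) = 0 :=
    (measure_biUnion_null_iff (Finset.countable_toSet _)).2 fun z hz => (Finset.mem_filter.1 hz).2
  have hcover : (⋃ z ∈ {z ∈ s | ν (Metric.ball z r) ≠ 0}, Metric.ball z r)ᶜ ⊆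
      Kᶜ ∪ ⋃ z ∈ {z ∈ s | ν (Metric.ball z r) = 0}, Metric.ball z r := by
    intro x hx
    by_cases hxK : x ∈ K
    · obtain ⟨z, hz, hxz⟩ := Set.mem_iUnion₂.1 (hKs hxK)
      refine Or.inr (Set.mem_iUnion₂.2 ⟨z, Finset.mem_filter.2 ⟨hz, ?_⟩, hxz⟩)
      by_contra hpos
      exact hx (Set.mem_iUnion₂.2 ⟨z, Finset.mem_filter.2 ⟨hz, hpos⟩, hxz⟩)
    · exact Or.inl hxK
  calc _ ≤ ν Kᶜ + ν (⋃ z ∈ {z ∈ s | ν (Metric.ball z r) = 0}, Metric.ball z r) :=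
        (measure_mono hcover).trans (measure_union_le _ _)
    _ ≤ ε := by simpa only [hnull, add_zero] using hνK ν rfl

section StochasticOrder

variable {Ω : Type*} [MeasurableSpace Ω] {μ : Measure Ω}

theorem WithProbTendingToOne.mono {A B : ℕ → Set Ω} (hA : WithProbTendingToOne μ A)
    (hAB : ∀ᶠ n in atTop, A n ⊆ B n) : WithProbTendingToOne μ B :=
  tendsto_of_tendsto_of_tendsto_of_le_of_le' tendsto_const_nhds hA
    (Eventually.of_forall fun _ => zero_le)
    (hAB.mono fun _ h => measure_mono (Set.compl_subset_compl.2 h))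

theorem WithProbTendingToOne.inter {A B : ℕ → Set Ω} (hA : WithProbTendingToOne μ A)
    (hB : WithProbTendingToOne μ B) : WithProbTendingToOne μ fun n => A n ∩ B n := by
  refine tendsto_of_tendsto_of_tendsto_of_le_of_le tendsto_const_nhds
    (by simpa using Tendsto.add hA hB) (fun _ => zero_le) fun n => ?_
  rw [Set.compl_inter]
  exact measure_union_le _ _

theorem WithProbTendingToOne.exists_nonempty [NeZero μ] {A : ℕ → Set Ω}
    (hA : WithProbTendingToOne μ A) : ∃ n, (A n).Nonempty := by
  obtain ⟨n, hn⟩ := (hA.eventually_lt_const (Measure.measure_univ_pos.2 (NeZero.ne μ))).exists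
  exact ⟨n, Set.nonempty_iff_ne_empty.2 fun h => by simp [h] at hn⟩

theorem isLittleOP_iff {r : ℝ} {Y : ℕ → Ω → ℝ≥0∞} :
    IsLittleOP μ r Y ↔ ∀ ε : ℝ, 0 < ε →
      WithProbTendingToOne μ fun n => {ω | Y n ω < ENNReal.ofReal (ε * (n : ℝ) ^ (-r))} := by
  simp only [IsLittleOP, WithProbTendingToOne, Set.compl_ofPred, not_lt]

theorem isLittleOP_zero_iff {Y : ℕ → Ω → ℝ≥0∞} :
    IsLittleOP μ 0 Y ↔ ∀ ε : ℝ≥0∞, 0 < ε → WithProbTendingToOne μ fun n => {ω | Y n ω < ε} := by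
  simp only [isLittleOP_iff, neg_zero, Real.rpow_zero, mul_one]
  refine ⟨fun h ε hε => ?_, fun h ε hε => h _ (ENNReal.ofReal_pos.2 hε)⟩
  obtain ⟨a, ha, haε⟩ := ENNReal.lt_iff_exists_nnreal_btwn.1 hε
  exact (h a (ENNReal.coe_pos.1 ha)).mono <| Eventually.of_forall fun n ω hω =>
    lt_trans (by simpa using hω) haε

namespace IsLittleOP

variable {r s : ℝ} {Y Z : ℕ → Ω → ℝ≥0∞}

theorem mono_of_withProbTendingToOne (hZ : IsLittleOP μ r Z)
    (hYZ : WithProbTendingToOne μ fun n => {ω | Y n ω ≤ Z n ω}) : IsLittleOP μ r Y :=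
  isLittleOP_iff.2 fun ε hε => (hYZ.inter (isLittleOP_iff.1 hZ ε hε)).mono <|
    Eventually.of_forall fun n ω hω => lt_of_le_of_lt (b := Z n ω) hω.1 hω.2

theorem mono (hZ : IsLittleOP μ r Z) (hYZ : ∀ n ω, Y n ω ≤ Z n ω) : IsLittleOP μ r Y :=
  hZ.mono_of_withProbTendingToOne <| by simp [WithProbTendingToOne, hYZ]

theorem of_exponent_le (hY : IsLittleOP μ r Y) (hsr : s ≤ r) : IsLittleOP μ s Y :=
  isLittleOP_iff.2 fun ε hε => (isLittleOP_iff.1 hY ε hε).mono <|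
    (eventually_ge_atTop 1).mono fun _ hn _ hω => lt_of_lt_of_le hω <| ENNReal.ofReal_le_ofReal <|
      mul_le_mul_of_nonneg_left
        (Real.rpow_le_rpow_of_exponent_le (Nat.one_le_cast.2 hn) (neg_le_neg hsr)) hε.le

theorem withProbTendingToOne_lt_top (hY : IsLittleOP μ r Y) :
    WithProbTendingToOne μ fun n => {ω | Y n ω < ∞} :=
  (isLittleOP_iff.1 hY 1 one_pos).mono <| Eventually.of_forall fun _ _ hω =>
    lt_trans hω ENNReal.ofReal_lt_top

theorem add (hY : IsLittleOP μ r Y) (hZ : IsLittleOP μ r Z) :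
    IsLittleOP μ r fun n ω => Y n ω + Z n ω := by
  refine isLittleOP_iff.2 fun ε hε => ((isLittleOP_iff.1 hY (ε / 2) (half_pos hε)).inter
    (isLittleOP_iff.1 hZ (ε / 2) (half_pos hε))).mono <| Eventually.of_forall fun n ω hω => ?_
  have hsplit : ENNReal.ofReal (ε * (n : ℝ) ^ (-r)) =
      ENNReal.ofReal (ε / 2 * (n : ℝ) ^ (-r)) + ENNReal.ofReal (ε / 2 * (n : ℝ) ^ (-r)) := by
    rw [← ENNReal.ofReal_add (by positivity) (by positivity), ← add_mul, add_halves]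
  exact (ENNReal.add_lt_add hω.1 hω.2).trans_eq hsplit.symm

theorem mul (hY : IsLittleOP μ r Y) (hZ : IsLittleOP μ s Z) :
    IsLittleOP μ (r + s) fun n ω => Y n ω * Z n ω := by
  refine isLittleOP_iff.2 fun ε hε => ((isLittleOP_iff.1 hY (√ε) (Real.sqrt_pos.2 hε)).inter
    (isLittleOP_iff.1 hZ (√ε) (Real.sqrt_pos.2 hε))).mono <|
    (eventually_gt_atTop 0).mono fun n hn ω hω => ?_
  have hsplit : ENNReal.ofReal (ε * (n : ℝ) ^ (-(r + s))) =
      ENNReal.ofReal (√ε * (n : ℝ) ^ (-r)) * ENNReal.ofReal (√ε * (n : ℝ) ^ (-s)) := by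
    rw [← ENNReal.ofReal_mul (by positivity), neg_add, Real.rpow_add (Nat.cast_pos.2 hn),
      mul_mul_mul_comm, Real.mul_self_sqrt hε.le]
  exact (ENNReal.mul_lt_mul hω.1 hω.2).trans_eq hsplit.symm

theorem ofReal_rpow_mul (hY : IsLittleOP μ r Y) (s : ℝ) :
    IsLittleOP μ (r + s) fun n ω => ENNReal.ofReal ((n : ℝ) ^ (-s)) * Y n ω := by
  refine isLittleOP_iff.2 fun ε hε => (isLittleOP_iff.1 hY ε hε).mono <|
    (eventually_gt_atTop 0).mono fun n hn ω hω => ?_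
  have hpos : 0 < (n : ℝ) ^ (-s) := Real.rpow_pos_of_pos (Nat.cast_pos.2 hn) _
  have hsplit : ENNReal.ofReal (ε * (n : ℝ) ^ (-(r + s))) =
      ENNReal.ofReal ((n : ℝ) ^ (-s)) * ENNReal.ofReal (ε * (n : ℝ) ^ (-r)) := by
    rw [← ENNReal.ofReal_mul hpos.le, neg_add, Real.rpow_add (Nat.cast_pos.2 hn)]
    ring_nf
  exact (ENNReal.mul_lt_mul_right (ENNReal.ofReal_pos.2 hpos).ne' ENNReal.ofReal_ne_top hω).trans_eq
    hsplit.symm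

theorem const_mul (hY : IsLittleOP μ r Y) {c : ℝ≥0∞} (hc : c ≠ ∞) :
    IsLittleOP μ r fun n ω => c * Y n ω := by
  lift c to NNReal using hc
  refine isLittleOP_iff.2 fun ε hε => (isLittleOP_iff.1 hY (ε / (c + 1)) (by positivity)).mono <|
    Eventually.of_forall fun n ω hω => ?_
  have hscale : ENNReal.ofReal (ε * (n : ℝ) ^ (-r)) =
      (c + 1 : NNReal) * ENNReal.ofReal (ε / (c + 1) * (n : ℝ) ^ (-r)) := by
    rw [← ENNReal.ofReal_coe_nnreal, ← ENNReal.ofReal_mul NNReal.zero_le_coe]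
    push_cast
    field_simp
  calc c * Y n ω ≤ (c + 1 : NNReal) * Y n ω := by gcongr; exact le_self_add
    _ < (c + 1 : NNReal) * ENNReal.ofReal (ε / (c + 1) * (n : ℝ) ^ (-r)) :=
        ENNReal.mul_lt_mul_right (by positivity) ENNReal.coe_ne_top hω
    _ = _ := hscale.symm

end IsLittleOP

end StochasticOrder

theorem eventually_div_sq_lt {c ε : ℝ≥0∞} (hc : c ≠ 0) (hε : 0 < ε) :
    ∀ᶠ τ in 𝓝[>] (0 : ℝ≥0∞), (τ / c) ^ 2 < ε := by
  have hcont : Continuous fun τ : ℝ≥0∞ => (τ / c) ^ 2 :=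
    (ENNReal.continuous_pow 2).comp (ENNReal.continuous_div_const c hc)
  have hlim : Tendsto (fun τ : ℝ≥0∞ => (τ / c) ^ 2) (𝓝 0) (𝓝 0) := by
    simpa using hcont.tendsto 0
  exact (hlim.mono_left nhdsWithin_le_nhds).eventually_lt_const hε

section SampleMean

variable {X : Type*} [MeasurableSpace X] {P : Measure X}

theorem enorm_integral_sq_le (u : X → ℝ) : ‖∫ x, u x ^ 2 ∂P‖ₑ ≤ eLpNorm u 2 P ^ 2 := by
  have hnorm : eLpNorm u 2 P ^ 2 = ∫⁻ x, ‖u x ^ 2‖ₑ ∂P := by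
    simpa [enorm_pow] using eLpNorm_nnreal_pow_eq_lintegral (f := u) (μ := P) two_ne_zero
  exact hnorm ▸ enorm_integral_le_lintegral_enorm _

variable [IsProbabilityMeasure P]

theorem measurePreserving_sample (n : ℕ) :
    MeasurePreserving (sample n) (iidLaw P) (Measure.pi fun _ : Fin n => P) := by
  refine ⟨by unfold sample; fun_prop, ?_⟩
  rw [← Measure.infinitePi_eq_pi]
  exact Measure.map_infinitePi_infinitePi_of_inj Fin.val_injective

theorem memLp_empMean {u : X → ℝ} {p : ℝ≥0∞} (hu : MemLp u p P) (n : ℕ) :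
    MemLp (fun x => empMean x u) p (Measure.pi fun _ : Fin n => P) := by
  simp only [empMean, div_eq_inv_mul]
  exact (memLp_finsetSum _ fun i _ =>
    hu.comp_measurePreserving (measurePreserving_eval _ i)).const_mul _

theorem integral_empMean {u : X → ℝ} (hu : Integrable u P) {n : ℕ} (hn : n ≠ 0) :
    ∫ x, empMean x u ∂(Measure.pi fun _ : Fin n => P) = ∫ x, u x ∂P := by
  have heval (i : Fin n) : ∫ x, u (x i) ∂(Measure.pi fun _ : Fin n => P) = ∫ x, u x ∂P :=
    integral_comp_eval hu.1
  simp only [empMean]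
  rw [integral_div, integral_finsetSum _ fun i _ => integrable_comp_eval hu]
  simp [heval, hn]

theorem variance_empMean {u : X → ℝ} (hu : MemLp u 2 P) (n : ℕ) :
    Var[fun x => empMean x u; Measure.pi fun _ : Fin n => P] = Var[u; P] / n := by
  have hsum := variance_sum_pi (μ := fun _ : Fin n => P) (X := fun _ => u) fun _ => hu
  have hmean : (fun x : Fin n → X => empMean x u) =
      fun x => (n : ℝ)⁻¹ * (∑ i, fun x : Fin n → X => u (x i)) x := by
    ext x
    simp [empMean, div_eq_inv_mul]
  rw [hmean, variance_const_mul, hsum]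
  rcases eq_or_ne n 0 with rfl | hn
  · simp
  · simp only [Finset.sum_const, Finset.card_univ, Fintype.card_fin, nsmul_eq_mul]
    field_simp

end SampleMean

section EmpiricalProcess

variable {X : Type*} [MeasurableSpace X] {P : Measure X}

theorem empG_sub {f g : X → ℝ} (hf : Integrable f P) (hg : Integrable g P) (n : ℕ) (ω : ℕ → X) :
    empG P n ω (f - g) = empG P n ω f - empG P n ω g := by
  simp only [empG, empMean, Pi.sub_apply, Finset.sum_sub_distrib, integral_sub hf hg]
  ring

theorem measure_le_abs_empG_le [IsProbabilityMeasure P] {u : X → ℝ} (hu : MemLp u 2 P) (n : ℕ)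
    {δ : ℝ} (hδ : 0 < δ) :
    iidLaw P {ω | δ ≤ |empG P n ω u|} ≤ (eLpNorm u 2 P / ENNReal.ofReal δ) ^ 2 := by
  rcases eq_or_ne n 0 with rfl | hn
  · simp [empG, hδ.not_ge]
  have hpres : MeasurePreserving (sample n) (iidLaw P) (Measure.pi fun _ : Fin n => P) :=
    measurePreserving_sample n
  have hroot : 0 < √(n : ℝ) := Real.sqrt_pos.2 (by positivity)
  have hmem : MemLp (fun ω => empMean (sample n ω) u) 2 (iidLaw P) :=
    (memLp_empMean hu n).comp_measurePreserving hpres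
  have hmean : ∫ ω, empMean (sample n ω) u ∂iidLaw P = ∫ x, u x ∂P := by
    rw [← integral_empMean (hu.integrable one_le_two) hn, ← hpres.map_eq,
      integral_map hpres.measurable.aemeasurable (hpres.map_eq ▸ (memLp_empMean hu n).1)]
  have hvar : Var[fun ω => empMean (sample n ω) u; iidLaw P] = Var[u; P] / n := by
    rw [hpres.variance_fun_comp (memLp_empMean hu n).1.aemeasurable, variance_empMean hu]
  have hevent (ω : ℕ → X) : δ ≤ |empG P n ω u| ↔
      δ / √n ≤ |empMean (sample n ω) u - ∫ ω, empMean (sample n ω) u ∂iidLaw P| := by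
    rw [empG, abs_mul, abs_of_pos hroot, hmean, div_le_iff₀' hroot]
  simp only [hevent]
  calc _ ≤ ENNReal.ofReal (Var[u; P] / n / (δ / √n) ^ 2) :=
        hvar ▸ meas_ge_le_variance_div_sq hmem (div_pos hδ hroot)
    _ = ENNReal.ofReal Var[u; P] / ENNReal.ofReal δ ^ 2 := by
        rw [← ENNReal.ofReal_pow hδ.le, ← ENNReal.ofReal_div_of_pos (by positivity), div_pow,
          Real.sq_sqrt n.cast_nonneg]
        field_simp
    _ ≤ ‖∫ x, u x ^ 2 ∂P‖ₑ / ENNReal.ofReal δ ^ 2 := by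
        gcongr
        exact (ENNReal.ofReal_le_ofReal (variance_le_expectation_sq hu.1)).trans
          (Real.ofReal_le_enorm _)
    _ ≤ eLpNorm u 2 P ^ 2 / ENNReal.ofReal δ ^ 2 := by gcongr; exact enorm_integral_sq_le u
    _ = _ := by simp only [div_eq_mul_inv, mul_pow, ENNReal.inv_pow]

theorem empGMap_apply {F : Set (X → ℝ)} {n : ℕ} {ω : ℕ → X}
    (h : ∃ C : ℝ, ∀ f ∈ F, |empG P n ω f| ≤ C) (f : F) :
    empGMap P F n ω f = empG P n ω f := by
  obtain ⟨C, hC⟩ := h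
  have hmem : Memℓp (fun f : F => empG P n ω f) ∞ :=
    memℓp_infty ⟨C, Set.forall_mem_range.2 fun f => hC f f.2⟩
  rw [empGMap, dif_pos hmem]

theorem abs_sub_le_abs_sub_add_two_mul_dist {α : Type*} {F : Set α} (z w : EllInfty F) (f g : F) :
    |z f - z g| ≤ |w f - w g| + 2 * dist z w := by
  have happly (h : F) : |z h - w h| ≤ dist z w := by
    simpa [dist_eq_norm] using lp.norm_apply_le_norm ENNReal.top_ne_zero (z - w) h
  have hf := abs_le.1 (happly f)
  have hg := abs_le.1 (happly g)
  have hw := abs_le.1 (le_refl |w f - w g|)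
  exact abs_le.2 ⟨by linarith, by linarith⟩

/-- Asymptotic equicontinuity of the empirical process over `F` in the `L²(P)` seminorm: when `n`
is large, `𝔾ₙ` is unlikely to differ by `δ` or more at two members of `F` within `τ`. The
events are not assumed measurable. -/
def IsAsymptoticallyUniformEquicontinuous (P : Measure X) [IsProbabilityMeasure P]
    (F : Set (X → ℝ)) : Prop :=
  ∀ δ : ℝ, 0 < δ → ∀ ε : ℝ≥0∞, 0 < ε → ∃ τ : ℝ≥0∞, 0 < τ ∧ ∀ᶠ n in atTop,
    iidLaw P {ω | ∃ f ∈ F, ∃ g ∈ F,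
      eLpNorm (f - g) 2 P < τ ∧ δ ≤ |empG P n ω f - empG P n ω g|} ≤ ε

/-- Asymptotic equicontinuity, along `F` and in the `L²(P)` seminorm, of the empirical process at a
single function `f₀`, which need not belong to `F`. -/
def IsAsymptoticallyEquicontinuousAt (P : Measure X) [IsProbabilityMeasure P]
    (F : Set (X → ℝ)) (f₀ : X → ℝ) : Prop :=
  ∀ δ : ℝ, 0 < δ → ∀ ε : ℝ≥0∞, 0 < ε → ∃ τ : ℝ≥0∞, 0 < τ ∧ ∀ᶠ n in atTop,
    iidLaw P {ω | ∃ f ∈ F, eLpNorm (f - f₀) 2 P < τ ∧ δ ≤ |empG P n ω f - empG P n ω f₀|} ≤ ε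

variable [IsProbabilityMeasure P] {F : Set (X → ℝ)}

theorem IsDonsker.measure_ball_le (hF : IsDonsker P F) {ν : Measure (EllInfty F)}
    [IsFiniteMeasure ν] (hν : WeaklyConverges (iidLaw P) (empGMap P F) ν) {f g : F}
    (hfg : MemLp (f.1 - g.1) 2 P) {z : EllInfty F} {r : ℝ} (hr : 0 < r)
    (hz : 3 * r ≤ |z f - z g|) :
    ν (Metric.ball z r) ≤ (eLpNorm (f.1 - g.1) 2 P / ENNReal.ofReal r) ^ 2 := by
  have hsub n : empGMap P F n ⁻¹' Metric.ball z r ≤ᵐ[iidLaw P]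
      {ω | r ≤ |empG P n ω (f.1 - g.1)|} := by
    filter_upwards [hF.bounded n] with ω hω (hball : dist (empGMap P F n ω) z < r)
    have hdist := abs_sub_le_abs_sub_add_two_mul_dist z (empGMap P F n ω) f g
    rw [empGMap_apply hω, empGMap_apply hω, dist_comm] at hdist
    change r ≤ |empG P n ω (f.1 - g.1)|
    rw [empG_sub (hF.integrable f f.2) (hF.integrable g g.2)]
    linarith
  exact (hν.le_liminf_measure_preimage Metric.isOpen_ball).trans <|
    liminf_le_of_le (by isBoundedDefault) fun b hb => by
      obtain ⟨n, hn⟩ := hb.exists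
      exact hn.trans ((measure_mono_ae (hsub n)).trans (measure_le_abs_empG_le hfg n hr))

theorem IsDonsker.isAsymptoticallyUniformEquicontinuous (hF : IsDonsker P F) :
    IsAsymptoticallyUniformEquicontinuous P F := by
  intro δ hδ ε hε
  obtain ⟨ν, _, hνt, hν⟩ := hF.weaklyConverges
  obtain ⟨r, hr, rfl⟩ : ∃ r : ℝ, 0 < r ∧ 5 * r = δ := ⟨δ / 5, by positivity, by ring⟩
  obtain ⟨ε', hε', hlt⟩ := exists_between hε
  obtain ⟨t, ht, htε⟩ := exists_finset_measure_ball_ne_zero hνt hr hε'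
  obtain ⟨τ, hτt, hτ⟩ := (((Finset.eventually_all t).2 fun z hz => eventually_div_sq_lt
    (ENNReal.ofReal_pos.2 hr).ne' (pos_iff_ne_zero.2 (ht z hz))).and self_mem_nhdsWithin).exists
  have hcentre : ∀ z ∈ t, ∀ f g : F, eLpNorm (f.1 - g.1) 2 P < τ → |z f - z g| < 3 * r := by
    intro z hz f g hfg
    by_contra! hfar
    have hmem : MemLp (f.1 - g.1) 2 P :=
      ⟨((hF.measurable f f.2).sub (hF.measurable g g.2)).aestronglyMeasurable,
        hfg.trans_le le_top⟩
    refine (hτt z hz).not_ge ((hF.measure_ball_le hν hmem hr hfar).trans ?_)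
    gcongr
  have hclosed : IsClosed (⋃ z ∈ t, Metric.ball z r)ᶜ :=
    (isOpen_biUnion fun _ _ => Metric.isOpen_ball).isClosed_compl
  refine ⟨τ, hτ, (eventually_lt_of_limsup_lt
    (((hν.limsup_measure_preimage_le hclosed).trans htε).trans_lt hlt)).mono fun n hn => ?_⟩
  refine (measure_mono_ae ?_).trans hn.le
  filter_upwards [hF.bounded n] with ω hω
  rintro ⟨f, hf, g, hg, hfg, hfar⟩ hball
  obtain ⟨z, hz, hωz⟩ := Set.mem_iUnion₂.1 hball
  have hdist := abs_sub_le_abs_sub_add_two_mul_dist (empGMap P F n ω) z ⟨f, hf⟩ ⟨g, hg⟩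
  rw [empGMap_apply hω, empGMap_apply hω] at hdist
  linarith [hcentre z hz ⟨f, hf⟩ ⟨g, hg⟩ hfg, Metric.mem_ball.1 hωz]

theorem IsDonsker.isAsymptoticallyEquicontinuousAt (hF : IsDonsker P F) {f₀ : X → ℝ}
    (hf₀ : MemLp f₀ 2 P) (hclosure : ∀ ρ : ℝ≥0∞, 0 < ρ → ∃ g ∈ F, eLpNorm (g - f₀) 2 P < ρ) :
    IsAsymptoticallyEquicontinuousAt P F f₀ := by
  intro δ hδ ε hε
  obtain ⟨τ, hτ, hequi⟩ :=
    hF.isAsymptoticallyUniformEquicontinuous (δ / 2) (half_pos hδ) (ε / 2) (ENNReal.half_pos hε.ne')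
  have hchebyshev := eventually_div_sq_lt (ENNReal.ofReal_pos.2 (half_pos hδ)).ne'
    (ENNReal.half_pos hε.ne')
  have hhalf : ∀ᶠ ρ in 𝓝[>] (0 : ℝ≥0∞), ρ < τ / 2 :=
    nhdsWithin_le_nhds (Iio_mem_nhds (ENNReal.half_pos hτ.ne'))
  obtain ⟨ρ, ⟨hρε, hρτ⟩, hρ⟩ := ((hchebyshev.and hhalf).and self_mem_nhdsWithin).exists
  obtain ⟨g, hg, hgρ⟩ := hclosure ρ hρ
  have hgf₀ : MemLp (g - f₀) 2 P :=
    ⟨(hF.measurable g hg).aestronglyMeasurable.sub hf₀.1, hgρ.trans_le le_top⟩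
  refine ⟨τ / 2, ENNReal.half_pos hτ.ne', hequi.mono fun n hn => ?_⟩
  have hcover :
      {ω | ∃ f ∈ F, eLpNorm (f - f₀) 2 P < τ / 2 ∧ δ ≤ |empG P n ω f - empG P n ω f₀|} ⊆
      {ω | ∃ f ∈ F, ∃ g ∈ F, eLpNorm (f - g) 2 P < τ ∧ δ / 2 ≤ |empG P n ω f - empG P n ω g|} ∪
        {ω | δ / 2 ≤ |empG P n ω (g - f₀)|} := by
    rintro ω ⟨f, hf, hff₀, hfar⟩
    by_cases hnear : δ / 2 ≤ |empG P n ω (g - f₀)|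
    · exact Or.inr hnear
    refine Or.inl ⟨f, hf, g, hg, ?_, ?_⟩
    · calc eLpNorm (f - g) 2 P = eLpNorm (f - f₀ - (g - f₀)) 2 P := by
            rw [sub_sub_sub_cancel_right]
        _ ≤ eLpNorm (f - f₀) 2 P + eLpNorm (g - f₀) 2 P :=
            eLpNorm_sub_le ((hF.measurable f hf).aestronglyMeasurable.sub hf₀.1) hgf₀.1 one_le_two
        _ < τ / 2 + τ / 2 := ENNReal.add_lt_add hff₀ (hgρ.trans hρτ)
        _ = τ := ENNReal.add_halves τ
    · rw [empG_sub (hF.integrable g hg) (hf₀.integrable one_le_two)] at hnear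
      linarith [abs_sub_le (empG P n ω f) (empG P n ω g) (empG P n ω f₀)]
  calc _ ≤ _ := measure_mono hcover
    _ ≤ _ := measure_union_le _ _
    _ ≤ ε / 2 + (eLpNorm (g - f₀) 2 P / ENNReal.ofReal (δ / 2)) ^ 2 :=
        add_le_add hn (measure_le_abs_empG_le hgf₀ n (half_pos hδ))
    _ ≤ ε / 2 + ε / 2 := by gcongr; exact le_trans (by gcongr) hρε.le
    _ = ε := ENNReal.add_halves ε

theorem IsAsymptoticallyEquicontinuousAt.isLittleOP_enorm_empG_sub {f₀ : X → ℝ}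
    (hequi : IsAsymptoticallyEquicontinuousAt P F f₀) {f : ℕ → (ℕ → X) → X → ℝ}
    (hfF : WithProbTendingToOne (iidLaw P) fun n => {ω | f n ω ∈ F})
    (hf : IsLittleOP (iidLaw P) 0 fun n ω => eLpNorm (f n ω - f₀) 2 P) :
    IsLittleOP (iidLaw P) 0 fun n ω => ‖empG P n ω (f n ω) - empG P n ω f₀‖ₑ := by
  intro δ hδ
  refine ENNReal.tendsto_nhds_zero.2 fun ε hε => ?_
  obtain ⟨τ, hτ, hn⟩ := hequi δ hδ (ε / 2) (ENNReal.half_pos hε.ne')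
  have hgood := ENNReal.tendsto_nhds_zero.1 (hfF.inter (isLittleOP_zero_iff.1 hf τ hτ)) (ε / 2)
    (ENNReal.half_pos hε.ne')
  filter_upwards [hn, hgood] with n hn hgood
  refine (measure_mono fun ω hω => ?_).trans <| (measure_union_le _ _).trans <|
    (add_le_add hn hgood).trans_eq (ENNReal.add_halves ε)
  by_cases hωgood : f n ω ∈ F ∧ eLpNorm (f n ω - f₀) 2 P < τ
  · refine Or.inl ⟨f n ω, hωgood.1, hωgood.2, ?_⟩
    simpa [Real.enorm_eq_ofReal_abs, ENNReal.ofReal_le_ofReal_iff] using hω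
  · exact Or.inr hωgood

end EmpiricalProcess

section AverageDensity

variable {X : Type*} [MeasurableSpace X] {lam P : Measure X} {η₀ : X → ℝ}

theorem IsDensityOf.integral_eq (h : IsDensityOf lam η₀ P) (g : X → ℝ) :
    ∫ x, g x ∂P = ∫ x, η₀ x * g x ∂lam := by
  rw [h.eq_withDensity, integral_withDensity_eq_integral_toReal_smul
    h.measurable.ennreal_ofReal (ae_of_all _ fun _ => ENNReal.ofReal_lt_top)]
  exact integral_congr_ae (h.nonneg.mono fun x hx => by simp [ENNReal.toReal_ofReal hx])

theorem IsDensityOf.integral_self (h : IsDensityOf lam η₀ P) :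
    ∫ x, η₀ x ∂P = avgDensity lam η₀ := by
  simp only [h.integral_eq, avgDensity, sq]

theorem IsDensityOf.integrable [IsFiniteMeasure P] (h : IsDensityOf lam η₀ P) :
    Integrable η₀ lam := by
  refine ⟨h.measurable.aestronglyMeasurable, ?_⟩
  rw [hasFiniteIntegral_iff_ofReal h.nonneg, ← setLIntegral_univ,
    ← withDensity_apply _ MeasurableSet.univ, ← h.eq_withDensity]
  exact measure_lt_top P Set.univ

theorem IsDensityOf.le_smul (h : IsDensityOf lam η₀ P) : P ≤ eLpNorm η₀ ∞ lam • lam := by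
  have hbound : ∀ᵐ x ∂lam, ENNReal.ofReal (η₀ x) ≤ eLpNorm η₀ ∞ lam :=
    (enorm_ae_le_eLpNormEssSup η₀ lam).mono fun x hx => (Real.ofReal_le_enorm _).trans hx
  calc P = lam.withDensity fun x => ENNReal.ofReal (η₀ x) := h.eq_withDensity
    _ ≤ lam.withDensity fun _ => eLpNorm η₀ ∞ lam := withDensity_mono hbound
    _ = eLpNorm η₀ ∞ lam • lam := withDensity_const _

theorem IsDensityOf.memLp_two [IsFiniteMeasure P] (h : IsDensityOf lam η₀ P)
    (htop : eLpNorm η₀ ∞ lam < ∞) : MemLp η₀ 2 lam := by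
  rw [memLp_two_iff_integrable_sq h.measurable.aestronglyMeasurable]
  simpa only [sq, Pi.mul_def] using
    h.integrable.mul_of_top_left ⟨h.measurable.aestronglyMeasurable, htop⟩

theorem IsDensityOf.memLp_two_self [IsFiniteMeasure P] (h : IsDensityOf lam η₀ P)
    (htop : eLpNorm η₀ ∞ lam < ∞) : MemLp η₀ 2 P :=
  (h.memLp_two htop).of_measure_le_smul htop.ne h.le_smul

theorem memLp_influence [IsFiniteMeasure P] {p : ℝ≥0∞} (hη₀ : MemLp η₀ p P) :
    MemLp (influence lam η₀) p P :=
  (hη₀.sub (memLp_const _)).const_mul 2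

theorem IsDensityOf.integral_influence [IsProbabilityMeasure P] (h : IsDensityOf lam η₀ P)
    (hη₀ : Integrable η₀ P) : ∫ x, influence lam η₀ x ∂P = 0 := by
  simp only [influence]
  rw [integral_const_mul, integral_sub hη₀ (integrable_const _), h.integral_self]
  simp

theorem empMean_influence {n : ℕ} (hn : n ≠ 0) (x : Fin n → X) (η₀ : X → ℝ) :
    empMean x (influence lam η₀) = 2 * (empMean x η₀ - avgDensity lam η₀) := by
  simp only [empMean, influence, ← Finset.mul_sum, Finset.sum_sub_distrib, Finset.sum_const,
    Finset.card_univ, Fintype.card_fin, nsmul_eq_mul]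
  field_simp

theorem empMean_sub_integral {n : ℕ} (hn : n ≠ 0) (ω : ℕ → X) (f : X → ℝ) :
    empMean (sample n ω) f - ∫ x, f x ∂P = (n : ℝ) ^ (-(1 / 2) : ℝ) * empG P n ω f := by
  have hroot : √(n : ℝ) ≠ 0 := (Real.sqrt_pos.2 (by positivity)).ne'
  rw [empG, Real.rpow_neg n.cast_nonneg, ← Real.sqrt_eq_rpow, inv_mul_cancel_left₀ hroot]

theorem IsDensityOf.integral_sub_sq (h : IsDensityOf lam η₀ P) (hη₀ : MemLp η₀ 2 lam) {e : X → ℝ}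
    (he : MemLp e 2 lam) :
    ∫ x, (e x - η₀ x) ^ 2 ∂lam = avgDensity lam e - 2 * ∫ x, e x ∂P + avgDensity lam η₀ := by
  have hcross : Integrable (fun x => 2 * (η₀ x * e x)) lam := (hη₀.integrable_mul he).const_mul 2
  have hlinear : Integrable (fun x => e x ^ 2 - 2 * (η₀ x * e x)) lam :=
    he.integrable_sq.sub hcross
  have hexpand : (fun x => (e x - η₀ x) ^ 2) = fun x => e x ^ 2 - 2 * (η₀ x * e x) + η₀ x ^ 2 := by
    ext x
    ring
  rw [hexpand, integral_add hlinear hη₀.integrable_sq,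
    integral_sub he.integrable_sq hcross, integral_const_mul, ← h.integral_eq, avgDensity,
    avgDensity]

theorem IsDensityOf.oneStep_vonMises_expansion (h : IsDensityOf lam η₀ P) (hη₀ : MemLp η₀ 2 lam)
    (η : ∀ n : ℕ, (Fin n → X) → X → ℝ) {n : ℕ} (hn : n ≠ 0) (ω : ℕ → X)
    (hη : MemLp (η n (sample n ω)) 2 lam) :
    oneStep lam η n (sample n ω) - avgDensity lam η₀ - empMean (sample n ω) (influence lam η₀) =
      2 * ((n : ℝ) ^ (-(1 / 2) : ℝ) * (empG P n ω (η n (sample n ω)) - empG P n ω η₀)) -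
        ∫ x, (η n (sample n ω) x - η₀ x) ^ 2 ∂lam := by
  rw [mul_sub, ← empMean_sub_integral hn, ← empMean_sub_integral hn, h.integral_sub_sq hη₀ hη,
    empMean_influence hn, h.integral_self, oneStep]
  ring

theorem IsDensityOf.enorm_oneStep_remainder_le (h : IsDensityOf lam η₀ P) (hη₀ : MemLp η₀ 2 lam)
    (η : ∀ n : ℕ, (Fin n → X) → X → ℝ) {n : ℕ} (hn : n ≠ 0) (ω : ℕ → X)
    (hη : MemLp (η n (sample n ω) - η₀) 2 lam) :
    ‖oneStep lam η n (sample n ω) - avgDensity lam η₀ -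
        empMean (sample n ω) (influence lam η₀)‖ₑ ≤
      2 * (ENNReal.ofReal ((n : ℝ) ^ (-(1 / 2) : ℝ)) *
          ‖empG P n ω (η n (sample n ω)) - empG P n ω η₀‖ₑ) +
        eLpNorm (η n (sample n ω) - η₀) 2 lam * eLpNorm (η n (sample n ω) - η₀) 2 lam := by
  have hmem : MemLp (η n (sample n ω)) 2 lam := by simpa using hη.add hη₀
  rw [h.oneStep_vonMises_expansion hη₀ η hn ω hmem, ← sq]
  refine (enorm_sub_le).trans (add_le_add (le_of_eq ?_) (enorm_integral_sq_le _))
  rw [enorm_mul, enorm_mul, Real.enorm_eq_ofReal (by positivity : 0 ≤ (n : ℝ) ^ (-(1 / 2) : ℝ)),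
    Real.enorm_eq_ofReal zero_le_two, ENNReal.ofReal_ofNat]

variable [IsProbabilityMeasure P] {η : ∀ n : ℕ, (Fin n → X) → X → ℝ}

theorem IsDensityOf.isLittleOP_enorm_empG_sub (h : IsDensityOf lam η₀ P)
    (htop : eLpNorm η₀ ∞ lam < ∞) {F : Set (X → ℝ)} (hF : IsDonsker P F)
    (hηF : WithProbTendingToOne (iidLaw P) fun n => {ω | η n (sample n ω) ∈ F})
    (hη : IsLittleOP (iidLaw P) 0 fun n ω => eLpNorm (η n (sample n ω) - η₀) 2 lam) :
    IsLittleOP (iidLaw P) 0 fun n ω => ‖empG P n ω (η n (sample n ω)) - empG P n ω η₀‖ₑ := by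
  have hconsistent : IsLittleOP (iidLaw P) 0 fun n ω => eLpNorm (η n (sample n ω) - η₀) 2 P :=
    (hη.const_mul (ENNReal.rpow_ne_top_of_nonneg ENNReal.toReal_nonneg htop.ne)).mono
      fun n ω => eLpNorm_le_of_measure_le_smul h.le_smul
  have hclosure : ∀ ρ : ℝ≥0∞, 0 < ρ → ∃ g ∈ F, eLpNorm (g - η₀) 2 P < ρ := fun ρ hρ => by
    obtain ⟨n, ω, hω⟩ := (hηF.inter (isLittleOP_zero_iff.1 hconsistent ρ hρ)).exists_nonempty
    exact ⟨_, hω⟩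
  exact (hF.isAsymptoticallyEquicontinuousAt (h.memLp_two_self htop)
    hclosure).isLittleOP_enorm_empG_sub hηF hconsistent

theorem isAsymptoticallyLinear_oneStep (h : IsDensityOf lam η₀ P) (htop : eLpNorm η₀ ∞ lam < ∞)
    {F : Set (X → ℝ)} (hF : IsDonsker P F)
    (hηF : WithProbTendingToOne (iidLaw P) fun n => {ω | η n (sample n ω) ∈ F})
    (hrate : IsLittleOP (iidLaw P) (1 / 4) fun n ω => eLpNorm (η n (sample n ω) - η₀) 2 lam) :
    IsAsymptoticallyLinear P (oneStep lam η) (avgDensity lam η₀) (influence lam η₀) := by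
  have hη₀ : MemLp η₀ 2 P := h.memLp_two_self htop
  refine ⟨memLp_influence hη₀, h.integral_influence (hη₀.integrable one_le_two), ?_⟩
  have hempirical := ((h.isLittleOP_enorm_empG_sub htop hF hηF
    (hrate.of_exponent_le (by norm_num))).ofReal_rpow_mul (1 / 2)).const_mul
      (c := 2) ENNReal.ofNat_ne_top
  have hquadratic := hrate.mul hrate
  rw [zero_add] at hempirical
  rw [show (1 / 4 + 1 / 4 : ℝ) = 1 / 2 by norm_num] at hquadratic
  refine (hempirical.add hquadratic).mono_of_withProbTendingToOne <|
    (hηF.inter hrate.withProbTendingToOne_lt_top).mono <|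
    (eventually_ne_atTop 0).mono fun n hn ω hω => ?_
  exact h.enorm_oneStep_remainder_le (h.memLp_two htop) η hn ω
    ⟨((hF.measurable _ hω.1).sub h.measurable).aestronglyMeasurable, hω.2⟩

theorem IsAsymptoticallyLinear.of_sub {T T' : ∀ n : ℕ, (Fin n → X) → ℝ} {ψ : ℝ} {φ : X → ℝ}
    (hT : IsAsymptoticallyLinear P T ψ φ)
    (hsub : IsLittleOP (iidLaw P) (1 / 2) fun n ω => ‖T' n (sample n ω) - T n (sample n ω)‖ₑ) :
    IsAsymptoticallyLinear P T' ψ φ := by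
  refine ⟨hT.memLp, hT.mean_zero, (hsub.add hT.remainder).mono fun n ω => ?_⟩
  refine le_trans (le_of_eq ?_) (enorm_add_le _ _)
  congr 1
  ring

end AverageDensity

end AvgDensity

open AvgDensity in
theorem proposition3_general {X : Type*} [MeasurableSpace X] {lam P : Measure X}
    [IsProbabilityMeasure P] {η₀ : X → ℝ} (hη₀ : IsDensityOf lam η₀ P)
    (htop : eLpNorm η₀ ∞ lam < ∞) {η : ∀ n : ℕ, (Fin n → X) → X → ℝ} {F : Set (X → ℝ)}
    (hF : IsDonsker P F)
    (hηF : WithProbTendingToOne (iidLaw P) fun n => {ω | η n (sample n ω) ∈ F})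
    (hrate : IsLittleOP (iidLaw P) (1 / 4) fun n ω => eLpNorm (η n (sample n ω) - η₀) 2 lam) :
    IsAsymptoticallyLinear P (oneStep lam η) (avgDensity lam η₀) (influence lam η₀) ∧
      (IsLittleOP (iidLaw P) (1 / 2) (fun n ω =>
          ‖avgDensity lam (η n (sample n ω)) - empMean (sample n ω) (η n (sample n ω))‖ₑ) →
        IsAsymptoticallyLinear P (plugIn lam η) (avgDensity lam η₀) (influence lam η₀) ∧
          IsAsymptoticallyLinear P (meanPlugIn η) (avgDensity lam η₀) (influence lam η₀)) := by
  have hone := isAsymptoticallyLinear_oneStep hη₀ htop hF hηF hrate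
  refine ⟨hone, fun hdiff => ?_⟩
  have hmean : IsAsymptoticallyLinear P (meanPlugIn η) (avgDensity lam η₀) (influence lam η₀) :=
    hone.of_sub <| hdiff.mono fun n ω => le_of_eq <| by
      rw [meanPlugIn, oneStep]
      congr 1
      ring
  exact ⟨hmean.of_sub hdiff, hmean⟩

theorem proposition3 {d : ℕ} (S : Set (EuclideanSpace ℝ (Fin d))) (hS : MeasurableSet S)
    (P₀ : Measure S) [IsProbabilityMeasure P₀]
    (η₀ : S → ℝ) (hη₀ : AvgDensity.IsDensityOf (AvgDensity.lebesgueOn S) η₀ P₀)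
    (η : ∀ n : ℕ, (Fin n → S) → S → ℝ)
    (F : Set (S → ℝ)) (hF : AvgDensity.IsDonsker P₀ F)
    (hηF : AvgDensity.WithProbTendingToOne (AvgDensity.iidLaw P₀)
      (fun n => {ω | η n (AvgDensity.sample n ω) ∈ F}))
    (M : ℝ) (hM : 0 < M)
    (hη₀M : eLpNorm η₀ ∞ (AvgDensity.lebesgueOn S) < ENNReal.ofReal M)
    (hηM : AvgDensity.WithProbTendingToOne (AvgDensity.iidLaw P₀)
      (fun n => {ω | eLpNorm (η n (AvgDensity.sample n ω)) ∞ (AvgDensity.lebesgueOn S)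
        < ENNReal.ofReal M}))
    (hrate : AvgDensity.IsLittleOP (AvgDensity.iidLaw P₀) (1 / 4)
      (fun n ω => eLpNorm (fun x => η n (AvgDensity.sample n ω) x - η₀ x) 2
        (AvgDensity.lebesgueOn S))) :
    AvgDensity.IsAsymptoticallyLinear P₀ (AvgDensity.oneStep (AvgDensity.lebesgueOn S) η)
        (AvgDensity.avgDensity (AvgDensity.lebesgueOn S) η₀) (AvgDensity.influence (AvgDensity.lebesgueOn S) η₀) ∧
      (AvgDensity.IsLittleOP (AvgDensity.iidLaw P₀) (1 / 2)
          (fun n ω => ‖AvgDensity.avgDensity (AvgDensity.lebesgueOn S) (η n (AvgDensity.sample n ω))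
            - AvgDensity.empMean (AvgDensity.sample n ω) (η n (AvgDensity.sample n ω))‖ₑ) →
        AvgDensity.IsAsymptoticallyLinear P₀ (AvgDensity.plugIn (AvgDensity.lebesgueOn S) η)
            (AvgDensity.avgDensity (AvgDensity.lebesgueOn S) η₀) (AvgDensity.influence (AvgDensity.lebesgueOn S) η₀) ∧
          AvgDensity.IsAsymptoticallyLinear P₀ (AvgDensity.meanPlugIn η)
            (AvgDensity.avgDensity (AvgDensity.lebesgueOn S) η₀) (AvgDensity.influence (AvgDensity.lebesgueOn S) η₀)) := by
  exact proposition3_general hη₀ (hη₀M.trans ENNReal.ofReal_lt_top) hF hηF hrate
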